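/- Let $n=s^2$ with $s\ge 1$ an integer, and let $m$ be an integer with $m\ge 2$ and $2m+1\le s$. Consider the $\sqrt n\times\sqrt n$ discrete torus (the product of two cycles of length $s=\sqrt n$) with $n$ agents, one starting at each site, agent $a$ holding an initial real value $x_a(0)$. At each time $t=1,2,\ldots$, independently of the past: (1) each agent moves, independently of the others, to a location chosen uniformly in the $(2m+1)\times(2m+1)$ square $\{i-m,\ldots,i+m\}\times\{j-m,\ldots,j+m\}$ (modulo $\sqrt n$) centred at its initial site $(i,j)$; (2) a uniformly random agent $a$ is selected, and it selects an agent $b$ uniformly among the other agents whose current location is equal or adjacent to that of $a$ (if there is none, nothing happens); (3) $a$ and $b$ both replace their values by $\frac12\left(x_a(t-1)+x_b(t-1)\right)$, and all other values are unchanged. For $\epsilon>0$ let $$T_{\mathrm{ave}}(n,\epsilon)=\sup_{x(0)\neq 0}\ \inf\left\{t\in\{0,1,2,\ldots\} : \Pr\left(\frac{\|x(t)-\bar x\,\vec 1\|_2}{\|x(0)\|_2}\ge \epsilon\right)\le\epsilon\right\},$$ where $\bar x$ is the average of the initial values and $\vec 1$ is the all-ones vector. Then $$T_{\mathrm{ave}}(n,\epsilon)=O\left(\frac{n^2\log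 m}{m^2}\,\log\epsilon^{-1}\right).$$ That is, there is a universal constant $C>0$ such that, for all such $n$ and $m$ and all $\epsilon$ with $0<\epsilon\le 1-\frac1n$ (in particular, for every fixed $\epsilon\in(0,1)$ and all $n\ge 1/(1-\epsilon)$), $T_{\mathrm{ave}}(n,\epsilon)\le C\,\frac{n^2\log m}{m^2}\log\epsilon^{-1}$. -/

import Mathlib

open scoped ENNReal

/-! Pairwise gossip with agent-based mobility.
Agents form a finite type `A`, locations the vertices `V` of a graph `G`; the agent `a` has a
fixed mobility distribution `μ a` on `V`. -/

theorem sum_prod_mobility {A V : Type*} [Fintype A] [Fintype V] (μ : A → PMF V) :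
    haveI := Classical.decEq A
    ∑ l : A → V, ∏ a, μ a (l a) = 1 := by
  classical
  have h := Finset.prod_univ_sum (fun _ : A => (Finset.univ : Finset V)) (fun a v => μ a v)
  rw [Fintype.piFinset_univ] at h
  have h1 : ∏ a, ∑ v, μ a v = 1 := Finset.prod_eq_one fun a _ => by
    rw [← tsum_fintype (L := .unconditional V)]
    exact (μ a).tsum_coe
  rw [← h1, h]

open Classical in
/-- The joint law of the agents' locations in one time step: independent, `a` being distributed
according to `μ a`. -/
noncomputable def locationsLaw {A V : Type*} [Fintype A] [Fintype V] (μ : A → PMF V) :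
    PMF (A → V) :=
  PMF.ofFintype (fun l => ∏ a, μ a (l a)) (by convert sum_prod_mobility μ)

open Classical in
/-- The other agents with which agent `i` can communicate when the locations are `l`: those whose
location equals, or is adjacent to, that of `i`. -/
noncomputable def neighbors {A V : Type*} [Fintype A] (G : SimpleGraph V) (l : A → V) (i : A) :
    Finset A :=
  {k : A | k ≠ i ∧ (l k = l i ∨ G.Adj (l i) (l k))}

open Classical in
/-- Agents `i` and `j` replace their values by the average of the two. -/
noncomputable def pairAverage {A : Type*} (i j : A) (x : EuclideanSpace ℝ A) :
    EuclideanSpace ℝ A :=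
  WithLp.toLp 2 fun k => if k = i ∨ k = j then (x i + x j) / 2 else x k

open Classical in
/-- The law of the value vector after one time step of the algorithm from the value vector `x`:
all agents move independently, a uniformly random agent `i` is selected, it selects a uniformly
random `j` among its neighbors, and `i`, `j` average. If `i` has no neighbor, nothing changes. -/
noncomputable def gossipStep {A V : Type*} [Fintype A] [Nonempty A] [Fintype V]
    (G : SimpleGraph V) (μ : A → PMF V) (x : EuclideanSpace ℝ A) : PMF (EuclideanSpace ℝ A) :=
  (locationsLaw μ).bind fun l =>
    (PMF.uniformOfFintype A).bind fun i =>
      if h : (neighbors G l i).Nonempty then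
        (PMF.uniformOfFinset (neighbors G l i) h).map fun j => pairAverage i j x
      else PMF.pure x

/-- The law of the value vector `x(t)` when `x(0) = x₀`; the steps use independent randomness. -/
noncomputable def gossipLaw {A V : Type*} [Fintype A] [Nonempty A] [Fintype V]
    (G : SimpleGraph V) (μ : A → PMF V) (x₀ : EuclideanSpace ℝ A) :
    ℕ → PMF (EuclideanSpace ℝ A)
  | 0 => PMF.pure x₀
  | t + 1 => (gossipLaw G μ x₀ t).bind (gossipStep G μ)

/-- The constant vector whose entries are the average of the entries of `x`. -/
noncomputable def averageVector {A : Type*} [Fintype A] (x : EuclideanSpace ℝ A) :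
    EuclideanSpace ℝ A :=
  WithLp.toLp 2 fun _ => (∑ a, x a) / (Fintype.card A : ℝ)

/-- The probability that `‖x(t) - x̄ 1‖ / ‖x(0)‖ ≥ ε` (Euclidean norm) when `x(0) = x₀`. -/
noncomputable def errorProb {A V : Type*} [Fintype A] [Nonempty A] [Fintype V]
    (G : SimpleGraph V) (μ : A → PMF V) (x₀ : EuclideanSpace ℝ A) (ε : ℝ) (t : ℕ) : ℝ≥0∞ :=
  (gossipLaw G μ x₀ t).toOuterMeasure {y | ε ≤ ‖y - averageVector x₀‖ / ‖x₀‖}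

/-- The `ε`-averaging time: the supremum over nonzero initial values of the first time `t` at which
the error is at least `ε` with probability at most `ε` (infinite if there is no such time). -/
noncomputable def averagingTime {A V : Type*} [Fintype A] [Nonempty A] [Fintype V]
    (G : SimpleGraph V) (μ : A → PMF V) (ε : ℝ) : ℕ∞ :=
  ⨆ (x₀ : EuclideanSpace ℝ A) (_ : x₀ ≠ 0),
    ⨅ (t : ℕ) (_ : errorProb G μ x₀ ε t ≤ ENNReal.ofReal ε), (t : ℕ∞)

/-- The `s × s` discrete torus: the product of two cycles of length `s`. -/
def torusGraph (s : ℕ) : SimpleGraph (ZMod s × ZMod s) :=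
  (SimpleGraph.circulantGraph ({1} : Set (ZMod s))).boxProd
    (SimpleGraph.circulantGraph ({1} : Set (ZMod s)))

/-- The square `{i - m, …, i + m} × {j - m, …, j + m}` modulo `s` centered at `v = (i, j)`. -/
noncomputable def localSquare (s m : ℕ) (v : ZMod s × ZMod s) : Finset (ZMod s × ZMod s) :=
  (Finset.Icc (-(m : ℤ)) m ×ˢ Finset.Icc (-(m : ℤ)) m).image
    fun d => (v.1 + (d.1 : ZMod s), v.2 + (d.2 : ZMod s))

theorem localSquare_nonempty (s m : ℕ) (v : ZMod s × ZMod s) : (localSquare s m v).Nonempty := by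
  refine Finset.Nonempty.image ⟨(0, 0), ?_⟩ _
  simp

/-- Local mobility: the agent starting at the site `v` moves uniformly in the square of side
`2m + 1` centered at `v`. There is one agent for each site of the torus. -/
noncomputable def localMobility (s m : ℕ) (v : ZMod s × ZMod s) : PMF (ZMod s × ZMod s) :=
  PMF.uniformOfFinset (localSquare s m v) (localSquare_nonempty s m v)

/-! The squared distance to consensus contracts in expectation. Averaging `i` and `j` lowers it by
exactly `(y i - y j) ^ 2 / 2`, so the expected loss in one step is a Dirichlet form weighted by
`contactProb`. A Poincaré inequality for that form with constant `g` gives decay `(1 - g) ^ t`, and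
Markov's inequality turns this into a bound on the averaging time.

Write `B` for the centred square and `β` for its size. Two agents whose homes differ by `d ∈ B`, `d
≠ 0`, share a site with probability at least `1 / (4β)`, and a neighbourhood holds at most five
agents on average; hence they are in contact with probability at least `1 / (24β)`
(`contactProb_ge`, `contactProb_localMobility_ge`).

For the Poincaré inequality (`disagreement_le_sum_translationEnergy`), the energy of a translation
by `d ∈ B` is bounded by an average over `B`, because `B` and `B + d` overlap substantially. Any
translation is a sum of `k ≈ s / m` such steps, which costs a factor `k ^ 2`, and the energies of
all translations sum to a multiple of the variance.

The size `β` cancels, leaving `g` of order `m ^ 2 / n ^ 2`. This already gives `n ^ 2 / m ^ 2 * log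
ε⁻¹`; the factor `log m` enters only through `log m ≥ 1 / 2`. -/

namespace PMF

/-! ### Expectations under discrete laws -/

variable {α β : Type*}

/-- The expectation of a nonnegative function. -/
noncomputable def expect (p : PMF α) (f : α → ℝ≥0∞) : ℝ≥0∞ :=
  ∑' a, p a * f a

theorem expect_bind (p : PMF α) (k : α → PMF β) (f : β → ℝ≥0∞) :
    (p.bind k).expect f = p.expect fun a => (k a).expect f := by
  simp only [expect, PMF.bind_apply, ← ENNReal.tsum_mul_right, ← ENNReal.tsum_mul_left, mul_assoc]
  exact ENNReal.tsum_comm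

theorem expect_pure (a : α) (f : α → ℝ≥0∞) : (PMF.pure a).expect f = f a := by
  rw [expect, tsum_eq_single a]
  · simp
  · intro b hb
    simp [PMF.pure_apply, hb]

theorem expect_map (p : PMF α) (g : α → β) (f : β → ℝ≥0∞) :
    (p.map g).expect f = p.expect fun a => f (g a) := by
  rw [← PMF.bind_pure_comp, expect_bind]
  simp [expect_pure]

theorem expect_const (p : PMF α) (c : ℝ≥0∞) : (p.expect fun _ => c) = c := by
  rw [expect, ENNReal.tsum_mul_right, p.tsum_coe, one_mul]

theorem expect_add (p : PMF α) (f g : α → ℝ≥0∞) :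
    (p.expect fun a => f a + g a) = p.expect f + p.expect g := by
  simp only [expect, mul_add, ENNReal.tsum_add]

theorem expect_mul_left (p : PMF α) (c : ℝ≥0∞) (f : α → ℝ≥0∞) :
    (p.expect fun a => c * f a) = c * p.expect f := by
  simp only [expect, ← ENNReal.tsum_mul_left]
  exact tsum_congr fun a => by ring

theorem expect_mono (p : PMF α) {f g : α → ℝ≥0∞} (h : ∀ a, f a ≤ g a) :
    p.expect f ≤ p.expect g :=
  ENNReal.tsum_le_tsum fun a => mul_le_mul_right (h a) _

theorem expect_eq_sum [Fintype α] (p : PMF α) (f : α → ℝ≥0∞) :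
    p.expect f = ∑ a, p a * f a :=
  tsum_fintype _

theorem expect_uniformOfFinset (s : Finset α) (hs : s.Nonempty) (f : α → ℝ≥0∞) :
    (PMF.uniformOfFinset s hs).expect f = ∑ a ∈ s, (s.card : ℝ≥0∞)⁻¹ * f a := by
  rw [expect, tsum_eq_sum (s := s)]
  · exact Finset.sum_congr rfl fun a ha => by rw [PMF.uniformOfFinset_apply_of_mem _ ha]
  · intro a ha
    rw [PMF.uniformOfFinset_apply_of_notMem _ ha, zero_mul]

/-- Markov's inequality. -/
theorem toOuterMeasure_le_of_one_le (p : PMF α) (S : Set α) (f : α → ℝ≥0∞)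
    (h : ∀ a ∈ p.support, a ∈ S → 1 ≤ f a) : p.toOuterMeasure S ≤ p.expect f := by
  rw [PMF.toOuterMeasure_apply]
  refine ENNReal.tsum_le_tsum fun a => ?_
  by_cases ha : a ∈ S
  · rw [Set.indicator_of_mem ha]
    by_cases hp : p a = 0
    · simp [hp]
    · exact le_mul_of_one_le_right' (h a ((p.mem_support_iff a).2 hp) ha)
  · simp [ha]

end PMF

/-! ### Contraction of the disagreement -/

section Gossip

variable {A V : Type*} [Fintype A]

/-- The squared distance of `y` to consensus. -/
noncomputable def disagreement (y : EuclideanSpace ℝ A) : ℝ :=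
  ‖y - averageVector y‖ ^ 2

theorem sum_pairAverage (i j : A) (y : EuclideanSpace ℝ A) :
    ∑ a, pairAverage i j y a = ∑ a, y a := by
  classical
  rcases eq_or_ne i j with rfl | hij
  · refine Finset.sum_congr rfl fun a _ => ?_
    by_cases h : a = i
    · subst h; simp [pairAverage]
    · simp [pairAverage, h]
  · rw [← sub_eq_zero, ← Finset.sum_sub_distrib,
      ← Finset.sum_subset (Finset.subset_univ {i, j}), Finset.sum_pair hij]
    · simp only [pairAverage, true_or, or_true, if_true]
      ring
    · intro a _ ha
      simp only [Finset.mem_insert, Finset.mem_singleton] at ha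
      simp [pairAverage, ha]

theorem averageVector_pairAverage (i j : A) (y : EuclideanSpace ℝ A) :
    averageVector (pairAverage i j y) = averageVector y := by
  simp only [averageVector, sum_pairAverage]

theorem disagreement_eq_sum (y : EuclideanSpace ℝ A) :
    disagreement y = ∑ a, (y a - (∑ b, y b) / (Fintype.card A : ℝ)) ^ 2 := by
  simp [disagreement, EuclideanSpace.norm_sq_eq, averageVector]

/-- The mean is unchanged, so only the terms at `i` and `j` matter, and the parallelogram identity
gives the exact loss. -/
theorem disagreement_pairAverage (i j : A) (y : EuclideanSpace ℝ A) :
    disagreement (pairAverage i j y) + (y i - y j) ^ 2 / 2 = disagreement y := by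
  classical
  rw [disagreement_eq_sum, disagreement_eq_sum, sum_pairAverage]
  set c := (∑ b, y b) / (Fintype.card A : ℝ)
  rcases eq_or_ne i j with rfl | hij
  · rw [sub_self, zero_pow two_ne_zero, zero_div, add_zero]
    refine Finset.sum_congr rfl fun a _ => ?_
    by_cases h : a = i
    · subst h; simp [pairAverage]
    · simp [pairAverage, h]
  · rw [← sub_eq_zero, add_sub_right_comm, ← Finset.sum_sub_distrib,
      ← Finset.sum_subset (Finset.subset_univ {i, j}), Finset.sum_pair hij]
    · simp only [pairAverage, true_or, or_true, if_true]
      ring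
    · intro a _ ha
      simp only [Finset.mem_insert, Finset.mem_singleton] at ha
      simp [pairAverage, ha]

theorem disagreement_le_norm_sq [Nonempty A] (y : EuclideanSpace ℝ A) :
    disagreement y ≤ ‖y‖ ^ 2 := by
  rw [disagreement_eq_sum, EuclideanSpace.norm_sq_eq]
  set c := (∑ b, y b) / (Fintype.card A : ℝ) with hc
  have hcard : (0 : ℝ) < Fintype.card A := by exact_mod_cast Fintype.card_pos
  have hs : ∑ b, y b = Fintype.card A * c := by rw [hc]; field_simp
  have h1 : ∑ a, (y a - c) ^ 2 = ∑ a, y a ^ 2 - Fintype.card A * c ^ 2 := by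
    have : ∀ a, (y a - c) ^ 2 = y a ^ 2 - 2 * c * y a + c ^ 2 := fun a => by ring
    simp only [this, Finset.sum_add_distrib, Finset.sum_sub_distrib, ← Finset.mul_sum, hs,
      Finset.sum_const, Finset.card_univ, nsmul_eq_mul]
    ring
  simp only [Real.norm_eq_abs, sq_abs]
  rw [h1]
  nlinarith [mul_nonneg hcard.le (sq_nonneg c)]

variable [Fintype V]

open Classical in
/-- The probability that `i`, once selected, selects `j`. -/
noncomputable def contactProb (G : SimpleGraph V) (μ : A → PMF V) (i j : A) : ℝ≥0∞ :=
  ∑ l, locationsLaw μ l * if j ∈ neighbors G l i then ((neighbors G l i).card : ℝ≥0∞)⁻¹ else 0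

variable [Nonempty A]

/-- Exact balance of one step: `e i j` is what `f` loses when `i` and `j` average. The additive form
avoids truncated subtraction in `ℝ≥0∞`. -/
theorem expect_gossipStep_add (G : SimpleGraph V) (μ : A → PMF V) (y : EuclideanSpace ℝ A)
    (f : EuclideanSpace ℝ A → ℝ≥0∞) (e : A → A → ℝ≥0∞)
    (h : ∀ i j, f (pairAverage i j y) + e i j = f y) :
    (gossipStep G μ y).expect f
      + (Fintype.card A : ℝ≥0∞)⁻¹ * ∑ i, ∑ j, contactProb G μ i j * e i j = f y := by
  classical
  have key : (Fintype.card A : ℝ≥0∞)⁻¹ * ∑ i, ∑ j, contactProb G μ i j * e i j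
      = (locationsLaw μ).expect fun l => (PMF.uniformOfFintype A).expect fun i =>
          ∑ j ∈ neighbors G l i, ((neighbors G l i).card : ℝ≥0∞)⁻¹ * e i j := by
    simp only [PMF.expect_eq_sum, PMF.uniformOfFintype_apply, contactProb, Finset.mul_sum,
      Finset.sum_mul]
    rw [Finset.sum_comm' (t' := Finset.univ) (s' := fun _ => Finset.univ) (by simp)]
    conv_lhs => enter [2, x]; rw [Finset.sum_comm]
    rw [Finset.sum_comm]
    refine Finset.sum_congr rfl fun l _ => ?_
    rw [Finset.sum_comm]
    refine Finset.sum_congr rfl fun i _ => ?_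
    rw [← Finset.sum_subset (Finset.subset_univ (neighbors G l i))]
    · refine Finset.sum_congr rfl fun j hj => ?_
      rw [if_pos hj]
      ring
    · intro j _ hj
      simp [hj]
  rw [key, gossipStep, PMF.expect_bind, ← PMF.expect_add]
  conv_rhs => rw [← PMF.expect_const (locationsLaw μ) (f y)]
  congr 1
  funext l
  rw [PMF.expect_bind, ← PMF.expect_add]
  conv_rhs => rw [← PMF.expect_const (PMF.uniformOfFintype A) (f y)]
  congr 1
  funext i
  split_ifs with hne
  · rw [PMF.expect_map, ← PMF.expect_uniformOfFinset _ hne, ← PMF.expect_add]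
    simp only [h, PMF.expect_const]
  · rw [Finset.not_nonempty_iff_eq_empty.1 hne, PMF.expect_pure, Finset.sum_empty, add_zero]

theorem averageVector_of_mem_support_gossipStep (G : SimpleGraph V) (μ : A → PMF V)
    {x y : EuclideanSpace ℝ A} (hy : y ∈ (gossipStep G μ x).support) :
    averageVector y = averageVector x := by
  rw [gossipStep, PMF.mem_support_bind_iff] at hy
  obtain ⟨l, -, hy⟩ := hy
  rw [PMF.mem_support_bind_iff] at hy
  obtain ⟨i, -, hy⟩ := hy
  split_ifs at hy with hne
  · rw [PMF.mem_support_map_iff] at hy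
    obtain ⟨j, -, rfl⟩ := hy
    exact averageVector_pairAverage i j x
  · rw [PMF.mem_support_pure_iff] at hy
    rw [hy]

theorem averageVector_of_mem_support_gossipLaw (G : SimpleGraph V) (μ : A → PMF V)
    (x₀ : EuclideanSpace ℝ A) (t : ℕ) :
    ∀ y ∈ (gossipLaw G μ x₀ t).support, averageVector y = averageVector x₀ := by
  induction t with
  | zero =>
    intro y hy
    rw [gossipLaw, PMF.mem_support_pure_iff] at hy
    rw [hy]
  | succ t ih =>
    intro y hy
    rw [gossipLaw, PMF.mem_support_bind_iff] at hy
    obtain ⟨z, hz, hy⟩ := hy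
    rw [averageVector_of_mem_support_gossipStep G μ hy, ih z hz]

theorem expect_gossipLaw_le (G : SimpleGraph V) (μ : A → PMF V) (x₀ : EuclideanSpace ℝ A)
    (f : EuclideanSpace ℝ A → ℝ≥0∞) (r : ℝ≥0∞)
    (h : ∀ y, (gossipStep G μ y).expect f ≤ r * f y) (t : ℕ) :
    (gossipLaw G μ x₀ t).expect f ≤ r ^ t * f x₀ := by
  induction t with
  | zero => simp [gossipLaw, PMF.expect_pure]
  | succ t ih =>
    rw [gossipLaw, PMF.expect_bind]
    calc _ ≤ (gossipLaw G μ x₀ t).expect fun y => r * f y := PMF.expect_mono _ h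
      _ = r * (gossipLaw G μ x₀ t).expect f := PMF.expect_mul_left _ _ _
      _ ≤ r * (r ^ t * f x₀) := mul_le_mul_right ih _
      _ = r ^ (t + 1) * f x₀ := by ring

/-- If one step contracts the expected disagreement by the factor `r`, then the error probability
decays like `r ^ t / ε ^ 2`. -/
theorem errorProb_le (G : SimpleGraph V) (μ : A → PMF V) {x₀ : EuclideanSpace ℝ A} (hx : x₀ ≠ 0)
    {ε r : ℝ} (hε : 0 < ε) (hr : 0 ≤ r)
    (h : ∀ y, (gossipStep G μ y).expect (fun z => ENNReal.ofReal (disagreement z))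
      ≤ ENNReal.ofReal r * ENNReal.ofReal (disagreement y)) (t : ℕ) :
    errorProb G μ x₀ ε t ≤ ENNReal.ofReal (r ^ t / ε ^ 2) := by
  have hx' : 0 < ‖x₀‖ := norm_pos_iff.2 hx
  have hc : 0 < ε ^ 2 * ‖x₀‖ ^ 2 := by positivity
  calc errorProb G μ x₀ ε t
      ≤ (gossipLaw G μ x₀ t).expect fun y =>
          ENNReal.ofReal (ε ^ 2 * ‖x₀‖ ^ 2)⁻¹ * ENNReal.ofReal (disagreement y) := by
        -- On the support the mean is still that of `x₀`, so the error event is a lower bound on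
        -- `disagreement y`.
        refine PMF.toOuterMeasure_le_of_one_le _ _ _ fun y hy hyS => ?_
        rw [← ENNReal.ofReal_mul (by positivity), ENNReal.one_le_ofReal,
          ← div_eq_inv_mul, one_le_div hc, disagreement,
          averageVector_of_mem_support_gossipLaw G μ x₀ t y hy, ← mul_pow]
        have : ε ≤ ‖y - averageVector x₀‖ / ‖x₀‖ := hyS
        rw [le_div_iff₀ hx'] at this
        exact pow_le_pow_left₀ (by positivity) this 2
    _ = ENNReal.ofReal (ε ^ 2 * ‖x₀‖ ^ 2)⁻¹ * (gossipLaw G μ x₀ t).expect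
          (fun y => ENNReal.ofReal (disagreement y)) := PMF.expect_mul_left _ _ _
    _ ≤ ENNReal.ofReal (ε ^ 2 * ‖x₀‖ ^ 2)⁻¹ *
          (ENNReal.ofReal r ^ t * ENNReal.ofReal (disagreement x₀)) :=
        mul_le_mul_right (expect_gossipLaw_le G μ x₀ _ _ h t) _
    _ = ENNReal.ofReal ((ε ^ 2 * ‖x₀‖ ^ 2)⁻¹ * (r ^ t * disagreement x₀)) := by
        rw [← ENNReal.ofReal_pow hr, ← ENNReal.ofReal_mul (by positivity),
          ← ENNReal.ofReal_mul (by positivity)]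
    _ ≤ ENNReal.ofReal (r ^ t / ε ^ 2) := by
        refine ENNReal.ofReal_le_ofReal ?_
        calc (ε ^ 2 * ‖x₀‖ ^ 2)⁻¹ * (r ^ t * disagreement x₀)
            ≤ (ε ^ 2 * ‖x₀‖ ^ 2)⁻¹ * (r ^ t * ‖x₀‖ ^ 2) := by
              have := disagreement_le_norm_sq x₀
              gcongr
          _ = r ^ t / ε ^ 2 := by field_simp

/-- A lower bound on the Dirichlet form of the contact probabilities makes one step a contraction
in expectation. -/
theorem expect_gossipStep_disagreement_le (G : SimpleGraph V) (μ : A → PMF V) {g : ℝ} (hg : 0 ≤ g)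
    (y : EuclideanSpace ℝ A)
    (h : ENNReal.ofReal (g * disagreement y) ≤ (Fintype.card A : ℝ≥0∞)⁻¹ *
      ∑ i, ∑ j, contactProb G μ i j * ENNReal.ofReal ((y i - y j) ^ 2 / 2)) :
    (gossipStep G μ y).expect (fun z => ENNReal.ofReal (disagreement z))
      ≤ ENNReal.ofReal (1 - g) * ENNReal.ofReal (disagreement y) := by
  have hd : ∀ z : EuclideanSpace ℝ A, 0 ≤ disagreement z := fun z => sq_nonneg _
  have key := expect_gossipStep_add G μ y (fun z => ENNReal.ofReal (disagreement z))
    (fun i j => ENNReal.ofReal ((y i - y j) ^ 2 / 2)) fun i j => by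
      rw [← ENNReal.ofReal_add (hd _) (by positivity), disagreement_pairAverage]
  rw [← ENNReal.ofReal_mul' (hd y), one_sub_mul,
    ENNReal.ofReal_sub _ (mul_nonneg hg (hd y))]
  refine ENNReal.le_sub_of_add_le_left ENNReal.ofReal_ne_top ?_
  rw [← key, add_comm]
  exact add_le_add_right h _

end Gossip

/-! ### Lower bound on contact probabilities -/

section Contact

/-- The convex function `c⁻¹` lies above its tangent at `K`. The bound is affine in `c - 1`, the
number of neighbors besides `j`, so its expectation needs only independence. -/
theorem tangent_le_inv {c K : ℝ} (hc : 0 < c) (hK : 0 < K) :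
    2 / K - 1 / K ^ 2 - 1 / K ^ 2 * (c - 1) ≤ c⁻¹ := by
  have h : c⁻¹ - (2 / K - 1 / K ^ 2 - 1 / K ^ 2 * (c - 1)) = (c - K) ^ 2 / (c * K ^ 2) := by
    field_simp
    ring
  rw [← sub_nonneg, h]
  positivity

variable {A V : Type*} [Fintype A] [Fintype V]

open Classical in
/-- Independence of the coordinates under a product weight. -/
theorem sum_prod_mul_prod {w : A → V → ℝ} (hw : ∀ a, ∑ v, w a v = 1) (S : Finset A)
    (g : A → V → ℝ) :
    ∑ l : A → V, (∏ a, w a (l a)) * ∏ a ∈ S, g a (l a) = ∏ a ∈ S, ∑ v, w a v * g a v := by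
  have h := Finset.prod_univ_sum (fun _ : A => (Finset.univ : Finset V))
    (fun a v => w a v * if a ∈ S then g a v else 1)
  rw [Fintype.piFinset_univ] at h
  have h1 : ∀ l : A → V, ∏ a, (w a (l a) * if a ∈ S then g a (l a) else 1)
      = (∏ a, w a (l a)) * ∏ a ∈ S, g a (l a) := fun l => by
    rw [Finset.prod_mul_distrib, Finset.prod_ite_mem, Finset.univ_inter]
  simp only [h1] at h
  rw [← h, ← Finset.prod_subset (Finset.subset_univ S)]
  · exact Finset.prod_congr rfl fun a ha => by simp [ha]
  · intro a _ ha
    simp [ha, hw]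

theorem sum_toReal_pmf (p : PMF V) : ∑ v, (p v).toReal = 1 := by
  rw [← ENNReal.toReal_sum fun v _ => p.apply_ne_top v, ← tsum_fintype (L := .unconditional V),
    p.tsum_coe, ENNReal.toReal_one]

open Classical in
/-- Two agents meet with probability at least a constant times that of being at the same site, if
the expected number of agents in every neighborhood is bounded. -/
theorem contactProb_ge (G : SimpleGraph V) (μ : A → PMF V) {D : ℝ} (hD : 0 ≤ D)
    (h : ∀ v, ∑ k, ∑ u with u = v ∨ G.Adj v u, (μ k u).toReal ≤ D) {i j : A} (hij : i ≠ j) :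
    ENNReal.ofReal ((∑ v, (μ i v).toReal * (μ j v).toReal) / (D + 1)) ≤ contactProb G μ i j := by
  set w : A → V → ℝ := fun a v => (μ a v).toReal with hwdef
  have hw : ∀ a, ∑ v, w a v = 1 := fun a => sum_toReal_pmf (μ a)
  have hw0 : ∀ a v, 0 ≤ w a v := fun a v => ENNReal.toReal_nonneg
  have hK : 0 < D + 1 := by linarith
  set R : Finset A := (Finset.univ.erase i).erase j with hR
  have hiR : i ∉ R := by simp [hR]
  have hjR : j ∉ R := by simp [hR]
  let I : V → V → ℝ := fun v u => if u = v then 1 else 0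
  let J : V → V → ℝ := fun v u => if u = v ∨ G.Adj v u then 1 else 0
  have hcp : contactProb G μ i j = ENNReal.ofReal (∑ l : A → V, (∏ a, w a (l a)) *
      if j ∈ neighbors G l i then ((neighbors G l i).card : ℝ)⁻¹ else 0) := by
    rw [contactProb, ENNReal.ofReal_sum_of_nonneg]
    · refine Finset.sum_congr rfl fun l _ => ?_
      rw [ENNReal.ofReal_mul (Finset.prod_nonneg fun a _ => hw0 a _)]
      congr 1
      · rw [hwdef, ← ENNReal.toReal_prod, ENNReal.ofReal_toReal]
        · simp [locationsLaw]
        · exact ENNReal.prod_ne_top fun a _ => (μ a).apply_ne_top _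
      · split_ifs with hj
        · rw [ENNReal.ofReal_inv_of_pos (by exact_mod_cast Finset.card_pos.2 ⟨j, hj⟩),
            ENNReal.ofReal_natCast]
        · simp
    · intro l _
      refine mul_nonneg (Finset.prod_nonneg fun a _ => hw0 a _) ?_
      split_ifs <;> positivity
  rw [hcp]
  refine ENNReal.ofReal_le_ofReal ?_
  -- Keep only the event that `i` and `j` share a site `v`. There the degree of `i` is one plus the
  -- number of agents of `R` near `v`, and the tangent bound at `D + 1` applies.
  have pointwise : ∀ l : A → V,
      ∑ v, ((2 / (D + 1) - 1 / (D + 1) ^ 2) * (I v (l i) * I v (l j))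
        - 1 / (D + 1) ^ 2 * ∑ k ∈ R, I v (l i) * (I v (l j) * J v (l k)))
      ≤ if j ∈ neighbors G l i then ((neighbors G l i).card : ℝ)⁻¹ else 0 := by
    intro l
    rw [Finset.sum_eq_single (l i)]
    · by_cases hl : l j = l i
      · have hj : j ∈ neighbors G l i := by simp [neighbors, hl, hij.symm]
        have hcard : ((neighbors G l i).card : ℝ) = 1 + ∑ k ∈ R, J (l i) (l k) := by
          have : neighbors G l i = insert j (R.filter fun k => l k = l i ∨ G.Adj (l i) (l k)) := by
            ext k
            simp only [neighbors, Finset.mem_filter, Finset.mem_univ, true_and,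
              Finset.mem_insert, hR, Finset.mem_erase]
            by_cases hk : k = j
            · subst hk; simp [hl, hij.symm]
            · simp [hk]
          rw [this, Finset.card_insert_of_notMem (by simp [hjR])]
          simp [J, add_comm]
        rw [if_pos hj]
        have hpos : (0 : ℝ) < (neighbors G l i).card := by
          exact_mod_cast Finset.card_pos.2 ⟨j, hj⟩
        simp only [I, if_true, hl, mul_one, one_mul]
        have hs : ∑ k ∈ R, J (l i) (l k) = (neighbors G l i).card - 1 := by rw [hcard]; ring
        rw [hs]
        set c : ℝ := ((neighbors G l i).card : ℝ)
        exact tangent_le_inv hpos hK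
      · have hI0 : I (l i) (l j) = 0 := if_neg hl
        simp only [hI0, mul_zero, zero_mul, Finset.sum_const_zero, sub_zero]
        split_ifs <;> positivity
    · intro v _ hv
      simp [I, hv.symm]
    · simp
  have hI : ∀ a v, ∑ u, w a u * I v u = w a v := fun a v => by simp [I]
  have hJ : ∀ a v, ∑ u, w a u * J v u = ∑ u with u = v ∨ G.Adj v u, w a u := fun a v => by
    simp [J, Finset.sum_filter]
  have two : ∀ v, ∑ l : A → V, (∏ a, w a (l a)) * (I v (l i) * I v (l j)) = w i v * w j v := by
    intro v
    have := sum_prod_mul_prod hw {i, j} (fun _ => I v)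
    simpa only [Finset.prod_pair hij, hI] using this
  have three : ∀ v, ∀ k ∈ R, ∑ l : A → V, (∏ a, w a (l a)) * (I v (l i) * (I v (l j) * J v (l k)))
      = w i v * (w j v * ∑ u with u = v ∨ G.Adj v u, w k u) := by
    intro v k hk
    have hki : i ≠ k := fun h => hiR (h ▸ hk)
    have hkj : j ≠ k := fun h => hjR (h ▸ hk)
    have := sum_prod_mul_prod hw {i, j, k} (fun a => if a = k then J v else I v)
    rw [Finset.prod_insert (by simp [hij, hki]), Finset.prod_pair hkj] at this
    simp only [Finset.prod_insert (show i ∉ ({j, k} : Finset A) by simp [hij, hki]),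
      Finset.prod_pair hkj, hki, hkj, if_false, if_true, hI, hJ] at this
    exact this
  calc (∑ v, w i v * w j v) / (D + 1)
      ≤ ∑ v, ((2 / (D + 1) - 1 / (D + 1) ^ 2) * (w i v * w j v)
        - 1 / (D + 1) ^ 2 * ∑ k ∈ R, w i v * (w j v * ∑ u with u = v ∨ G.Adj v u, w k u)) := by
        rw [Finset.sum_div]
        refine Finset.sum_le_sum fun v _ => ?_
        have hle : ∑ k ∈ R, ∑ u with u = v ∨ G.Adj v u, w k u ≤ D :=
          (Finset.sum_le_univ_sum_of_nonneg fun k => Finset.sum_nonneg fun u _ => hw0 k u).trans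
            (h v)
        simp only [← Finset.mul_sum]
        have hp : 0 ≤ w i v * w j v / (D + 1) ^ 2 := by
          have := mul_nonneg (hw0 i v) (hw0 j v)
          positivity
        -- The tangent point `D + 1` bounds the mean degree given the meeting, and at that value the
        -- tangent equals `1 / (D + 1)`.
        have heq : w i v * w j v / (D + 1)
            = (2 / (D + 1) - 1 / (D + 1) ^ 2) * (w i v * w j v)
              - w i v * w j v / (D + 1) ^ 2 * D := by
          field_simp
          ring
        rw [heq]
        have := mul_le_mul_of_nonneg_left hle hp
        calc _ ≤ (2 / (D + 1) - 1 / (D + 1) ^ 2) * (w i v * w j v) - w i v * w j v / (D + 1) ^ 2 *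
                ∑ k ∈ R, ∑ u with u = v ∨ G.Adj v u, w k u := sub_le_sub_left this _
          _ = _ := by ring
    _ = ∑ l : A → V, (∏ a, w a (l a)) *
          ∑ v, ((2 / (D + 1) - 1 / (D + 1) ^ 2) * (I v (l i) * I v (l j))
          - 1 / (D + 1) ^ 2 * ∑ k ∈ R, I v (l i) * (I v (l j) * J v (l k))) := by
        simp only [Finset.mul_sum (s := (Finset.univ : Finset V))]
        rw [Finset.sum_comm]
        refine Finset.sum_congr rfl fun v _ => ?_
        rw [← two v, ← Finset.sum_congr rfl (three v), Finset.sum_comm, Finset.mul_sum,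
          Finset.mul_sum, ← Finset.sum_sub_distrib]
        refine Finset.sum_congr rfl fun l _ => ?_
        rw [← Finset.mul_sum]
        ring
    _ ≤ _ := Finset.sum_le_sum fun l _ =>
        mul_le_mul_of_nonneg_left (pointwise l) (Finset.prod_nonneg fun a _ => hw0 a _)

end Contact

/-! ### Energies of translations on a finite abelian group -/

section Translation

variable {Γ : Type*} [AddCommGroup Γ] [Fintype Γ]

/-- The squared distance between a function and its translate. -/
def translationEnergy (x : Γ → ℝ) (d : Γ) : ℝ :=
  ∑ v, (x v - x (v + d)) ^ 2

theorem translationEnergy_nonneg (x : Γ → ℝ) (d : Γ) : 0 ≤ translationEnergy x d :=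
  Finset.sum_nonneg fun _ _ => sq_nonneg _

theorem translationEnergy_zero (x : Γ → ℝ) : translationEnergy x 0 = 0 := by
  simp [translationEnergy]

theorem sum_add_right_eq (f : Γ → ℝ) (d : Γ) : ∑ v, f (v + d) = ∑ v, f v :=
  Equiv.sum_comp (Equiv.addRight d) f

theorem translationEnergy_neg (x : Γ → ℝ) (d : Γ) :
    translationEnergy x (-d) = translationEnergy x d := by
  rw [translationEnergy, ← sum_add_right_eq _ d, translationEnergy]
  refine Finset.sum_congr rfl fun v _ => ?_
  rw [add_neg_cancel_right]
  ring

/-- Pointwise `k * (a + b) ^ 2 ≤ (k + 1) * a ^ 2 + k * (k + 1) * b ^ 2`, the difference being `(a -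
k * b) ^ 2`. These weights make `k` steps cost exactly `k ^ 2`. -/
theorem translationEnergy_add_le (x : Γ → ℝ) (d e : Γ) (k : ℝ) :
    k * translationEnergy x (d + e)
      ≤ (k + 1) * translationEnergy x d + k * (k + 1) * translationEnergy x e := by
  have he : translationEnergy x e = ∑ v, (x (v + d) - x (v + d + e)) ^ 2 :=
    (sum_add_right_eq (fun v => (x v - x (v + e)) ^ 2) d).symm
  rw [he, translationEnergy, translationEnergy, Finset.mul_sum, Finset.mul_sum, Finset.mul_sum,
    ← Finset.sum_add_distrib]
  refine Finset.sum_le_sum fun v _ => ?_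
  rw [← add_assoc]
  nlinarith [sq_nonneg ((x v - x (v + d)) - k * (x (v + d) - x (v + d + e)))]

/-- If a finite set overlaps sufficiently with its translate by `d`, then the energy at `d` is
controlled by the average energy over the set. -/
theorem card_overlap_mul_translationEnergy_le [DecidableEq Γ] (x : Γ → ℝ) (B : Finset Γ) (d : Γ) :
    ((B.filter fun e => e - d ∈ B).card : ℝ) * translationEnergy x d
      ≤ 4 * ∑ e ∈ B, translationEnergy x e := by
  set O := B.filter fun e => e - d ∈ B
  have h1 : ∑ e ∈ O, translationEnergy x e ≤ ∑ e ∈ B, translationEnergy x e :=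
    Finset.sum_le_sum_of_subset_of_nonneg (Finset.filter_subset _ _)
      fun e _ _ => translationEnergy_nonneg x e
  have h2 : ∑ e ∈ O, translationEnergy x (e - d) ≤ ∑ e ∈ B, translationEnergy x e := by
    rw [← Finset.sum_image (f := translationEnergy x) (g := fun e => e - d)
      (fun a _ b _ h => sub_left_injective h)]
    refine Finset.sum_le_sum_of_subset_of_nonneg ?_ fun e _ _ => translationEnergy_nonneg x e
    intro e he
    obtain ⟨a, ha, rfl⟩ := Finset.mem_image.1 he
    exact (Finset.mem_filter.1 ha).2
  have h3 : ∀ e ∈ O, translationEnergy x d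
      ≤ 2 * translationEnergy x e + 2 * translationEnergy x (e - d) := by
    intro e _
    have := translationEnergy_add_le x e (-(e - d)) 1
    rw [translationEnergy_neg, neg_sub, add_sub_cancel] at this
    linarith
  have h4 := Finset.sum_le_sum h3
  rw [Finset.sum_const, nsmul_eq_mul, Finset.sum_add_distrib, ← Finset.mul_sum,
    ← Finset.mul_sum] at h4
  linarith

/-- The total energy over all translations is twice the variance. -/
theorem sum_translationEnergy (x : EuclideanSpace ℝ Γ) :
    ∑ d, translationEnergy (fun v => x v) d = 2 * Fintype.card Γ * disagreement x := by
  have hcard : (0 : ℝ) < Fintype.card Γ := by exact_mod_cast Fintype.card_pos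
  rw [disagreement_eq_sum]
  set c := (∑ b, x b) / (Fintype.card Γ : ℝ) with hc
  have hsum : ∑ v, (x v - c) = 0 := by
    rw [Finset.sum_sub_distrib, Finset.sum_const, Finset.card_univ, nsmul_eq_mul, hc]
    field_simp
    ring
  simp only [translationEnergy]
  rw [Finset.sum_comm]
  have h : ∀ v, ∑ d, (x v - x (v + d)) ^ 2
      = Fintype.card Γ * (x v - c) ^ 2 + ∑ u, (x u - c) ^ 2 := by
    intro v
    rw [show ∑ d, (x v - x (v + d)) ^ 2 = ∑ u, (x v - x u) ^ 2 from
      Equiv.sum_comp (Equiv.addLeft v) fun u => (x v - x u) ^ 2]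
    have : ∀ u, (x v - x u) ^ 2 = (x v - c) ^ 2 - 2 * (x v - c) * (x u - c) + (x u - c) ^ 2 :=
      fun u => by ring
    simp only [this, Finset.sum_add_distrib, Finset.sum_sub_distrib, ← Finset.mul_sum, hsum,
      Finset.sum_const, Finset.card_univ, nsmul_eq_mul, mul_zero, sub_zero]
  simp only [h, Finset.sum_add_distrib, ← Finset.mul_sum, Finset.sum_const, Finset.card_univ,
    nsmul_eq_mul]
  ring

end Translation

/-! ### Poincaré inequality on the torus -/

section Torus

variable {s : ℕ}

/-- The energy on the torus grows at most quadratically with the number of steps. -/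
theorem translationEnergy_le_of_le_mul [NeZero s] (x : ZMod s × ZMod s → ℝ) (m : ℕ) {M : ℝ}
    (hM : ∀ a b : ℕ, a ≤ m → b ≤ m →
      translationEnergy x ((a : ZMod s), (b : ZMod s)) ≤ M) (k : ℕ) :
    ∀ a b : ℕ, a ≤ k * m → b ≤ k * m →
      translationEnergy x ((a : ZMod s), (b : ZMod s)) ≤ (k : ℝ) ^ 2 * M := by
  induction k with
  | zero =>
    intro a b ha hb
    obtain rfl : a = 0 := by omega
    obtain rfl : b = 0 := by omega
    have := translationEnergy_zero x
    simp only [Prod.zero_eq_mk] at this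
    simp [this]
  | succ k ih =>
    intro a b ha hb
    rcases Nat.eq_zero_or_pos k with rfl | hk
    · simpa using hM a b (by omega) (by omega)
    have hk' : (0 : ℝ) < k := by exact_mod_cast hk
    rw [Nat.succ_mul] at ha hb
    -- Peel off one step of at most `m` in each coordinate; the rest is within reach of `k` steps.
    have h1 := ih (a - min a m) (b - min b m) (by omega) (by omega)
    have h2 := hM (min a m) (min b m) (by omega) (by omega)
    have h3 := translationEnergy_add_le x
      (((a - min a m : ℕ) : ZMod s), ((b - min b m : ℕ) : ZMod s))
      (((min a m : ℕ) : ZMod s), ((min b m : ℕ) : ZMod s)) k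
    rw [Prod.mk_add_mk, ← Nat.cast_add, ← Nat.cast_add, Nat.sub_add_cancel (min_le_left _ _),
      Nat.sub_add_cancel (min_le_left _ _)] at h3
    refine le_of_mul_le_mul_left (h3.trans ?_) hk'
    have h4 := mul_le_mul_of_nonneg_left h1 (by positivity : (0 : ℝ) ≤ k + 1)
    have h5 := mul_le_mul_of_nonneg_left h2 (by positivity : (0 : ℝ) ≤ k * (k + 1))
    push_cast
    linarith

theorem mem_localSquare_iff (m : ℕ) (v w : ZMod s × ZMod s) :
    w ∈ localSquare s m v ↔ w - v ∈ localSquare s m 0 := by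
  simp only [localSquare, Finset.mem_image, Prod.fst_zero, Prod.snd_zero, zero_add,
    eq_sub_iff_add_eq', Prod.ext_iff, Prod.fst_add, Prod.snd_add]

theorem card_localSquare (m : ℕ) (v : ZMod s × ZMod s) :
    (localSquare s m v).card = (localSquare s m 0).card := by
  refine Finset.card_bij (fun w _ => w - v) (fun w hw => (mem_localSquare_iff m v w).1 hw)
    (fun a _ b _ h => sub_left_injective h) fun w hw => ⟨w + v, ?_, by simp⟩
  rw [mem_localSquare_iff]
  simpa using hw

theorem card_localSquare_le (m : ℕ) (v : ZMod s × ZMod s) :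
    (localSquare s m v).card ≤ (2 * m + 1) ^ 2 := by
  refine Finset.card_image_le.trans (le_of_eq ?_)
  rw [Finset.card_product, Int.card_Icc, sq]
  congr 1 <;> omega

theorem mem_localSquare_zero {m : ℕ} {d : ZMod s × ZMod s} :
    d ∈ localSquare s m 0 ↔ ∃ a b : ℤ, |a| ≤ m ∧ |b| ≤ m ∧ (a : ZMod s) = d.1 ∧
      (b : ZMod s) = d.2 := by
  simp only [localSquare, Finset.mem_image, Finset.mem_product, Finset.mem_Icc, Prod.exists,
    Prod.fst_zero, Prod.snd_zero, zero_add, Prod.ext_iff, abs_le, and_assoc]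

theorem intCast_injOn_Icc {lo : ℤ} {m : ℕ} (hm : m < s) :
    Set.InjOn (fun a : ℤ => (a : ZMod s)) (Set.Icc lo (lo + m)) := by
  intro a ha b hb h
  have h' := (ZMod.intCast_eq_intCast_iff_dvd_sub a b s).1 h
  have := Int.eq_zero_of_abs_lt_dvd h' (by
    rw [abs_lt]; constructor <;> [have := ha.2; have := hb.2] <;>
      have h1 := ha.1 <;> have h2 := hb.1 <;> omega)
  omega

/-- A square and its translate by one of its elements overlap in a quarter of the square. -/
theorem card_localSquare_le_overlap {m : ℕ} (hm : m < s) {d : ZMod s × ZMod s}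
    (hd : d ∈ localSquare s m 0) :
    (localSquare s m 0).card
      ≤ 4 * ((localSquare s m 0).filter fun e => e - d ∈ localSquare s m 0).card := by
  obtain ⟨a, b, ha, hb, ha', hb'⟩ := mem_localSquare_zero.1 hd
  rw [abs_le] at ha hb
  -- In each coordinate the overlap contains the `m + 1` integers from `max a 0 - m` to `max a 0`,
  -- distinct modulo `s`. Then `(2m + 1) ^ 2 ≤ 4 (m + 1) ^ 2`.
  have h : (m + 1) ^ 2
      ≤ ((localSquare s m 0).filter fun e => e - d ∈ localSquare s m 0).card := by
    have hcard : (Finset.Icc (max a 0 - m) (max a 0 - m + m)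
        ×ˢ Finset.Icc (max b 0 - m) (max b 0 - m + m)).card = (m + 1) ^ 2 := by
      rw [Finset.card_product, Int.card_Icc, Int.card_Icc, sq]
      congr 1 <;> omega
    rw [← hcard]
    refine Finset.card_le_card_of_injOn (fun p => ((p.1 : ZMod s), (p.2 : ZMod s))) ?_ ?_
    · intro p hp
      simp only [Finset.coe_product, Set.mem_prod, Finset.mem_coe, Finset.mem_Icc] at hp
      obtain ⟨⟨h1, h2⟩, h3, h4⟩ := hp
      simp only [Finset.coe_filter, Set.mem_ofPred_eq]
      constructor
      · exact mem_localSquare_zero.2 ⟨p.1, p.2, abs_le.2 ⟨by omega, by omega⟩,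
          abs_le.2 ⟨by omega, by omega⟩, rfl, rfl⟩
      · exact mem_localSquare_zero.2 ⟨p.1 - a, p.2 - b, abs_le.2 ⟨by omega, by omega⟩,
          abs_le.2 ⟨by omega, by omega⟩, by simp [ha'], by simp [hb']⟩
    · intro p hp q hq hpq
      simp only [Finset.coe_product, Set.mem_prod, Finset.mem_coe, Finset.mem_Icc] at hp hq
      simp only [Prod.mk.injEq] at hpq
      exact Prod.ext (intCast_injOn_Icc hm hp.1 hq.1 hpq.1)
        (intCast_injOn_Icc hm hp.2 hq.2 hpq.2)
  have h2 := card_localSquare_le m (0 : ZMod s × ZMod s)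
  nlinarith

/-- The Poincaré inequality on the torus for steps in a square. -/
theorem disagreement_le_sum_translationEnergy [NeZero s] {m : ℕ} (hm : m < s) {k : ℕ} (hk : s ≤ k * m)
    (x : EuclideanSpace ℝ (ZMod s × ZMod s)) :
    (localSquare s m 0).card * disagreement x
      ≤ 8 * (k : ℝ) ^ 2 * ∑ d ∈ localSquare s m 0, translationEnergy (fun v => x v) d := by
  set S := ∑ d ∈ localSquare s m 0, translationEnergy (fun v => x v) d
  have hB : (0 : ℝ) < (localSquare s m 0).card := by
    exact_mod_cast Finset.card_pos.2 (localSquare_nonempty s m 0)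
  -- The constant 16 is 4 from averaging over the overlap times 4 from the size of the overlap.
  have hM : ∀ a b : ℕ, a ≤ m → b ≤ m →
      translationEnergy (fun v => x v) ((a : ZMod s), (b : ZMod s))
        ≤ 16 * S / (localSquare s m 0).card := by
    intro a b ha hb
    have hd : ((a : ZMod s), (b : ZMod s)) ∈ localSquare s m 0 :=
      mem_localSquare_zero.2 ⟨a, b, by simpa using ha, by simpa using hb, by simp, by simp⟩
    have h1 := card_overlap_mul_translationEnergy_le (fun v => x v) (localSquare s m 0)
      ((a : ZMod s), (b : ZMod s))
    have h2 : ((localSquare s m 0).card : ℝ) ≤ 4 * ((localSquare s m 0).filter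
        fun e => e - ((a : ZMod s), (b : ZMod s)) ∈ localSquare s m 0).card := by
      exact_mod_cast card_localSquare_le_overlap hm hd
    rw [le_div_iff₀ hB]
    have := mul_le_mul_of_nonneg_right h2
      (translationEnergy_nonneg (fun v => x v) ((a : ZMod s), (b : ZMod s)))
    linarith
  have hall : ∀ d : ZMod s × ZMod s, translationEnergy (fun v => x v) d
      ≤ (k : ℝ) ^ 2 * (16 * S / (localSquare s m 0).card) := by
    rintro ⟨a, b⟩
    have := translationEnergy_le_of_le_mul (fun v => x v) m hM k a.val b.val
      (a.val_lt.le.trans hk) (b.val_lt.le.trans hk)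
    simpa only [ZMod.natCast_val, ZMod.cast_id', id_eq] using this
  have h1 := Finset.sum_le_sum fun d (_ : d ∈ Finset.univ) => hall d
  rw [sum_translationEnergy, Finset.sum_const, Finset.card_univ, nsmul_eq_mul] at h1
  have hcard : (0 : ℝ) < Fintype.card (ZMod s × ZMod s) := by exact_mod_cast Fintype.card_pos
  have h2 : 2 * disagreement x ≤ (k : ℝ) ^ 2 * (16 * S / (localSquare s m 0).card) :=
    le_of_mul_le_mul_left (by linarith) hcard
  rw [← mul_div_assoc, le_div_iff₀ hB] at h2
  linarith

end Torus

/-! ### Spectral gap under local mobility -/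

section LocalMobility

variable {s : ℕ}

open Classical in
theorem card_torusGraph_neighborhood_le [NeZero s] (v : ZMod s × ZMod s) :
    (Finset.univ.filter fun u => u = v ∨ (torusGraph s).Adj v u).card ≤ 5 := by
  have hsub : (Finset.univ.filter fun u => u = v ∨ (torusGraph s).Adj v u)
      ⊆ {v, (v.1 + 1, v.2), (v.1 - 1, v.2), (v.1, v.2 + 1), (v.1, v.2 - 1)} := by
    intro u hu
    simp only [Finset.mem_filter, Finset.mem_univ, true_and, torusGraph,
      SimpleGraph.boxProd_adj, SimpleGraph.circulantGraph_adj, Set.mem_singleton_iff] at hu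
    simp only [Finset.mem_insert, Finset.mem_singleton]
    rcases hu with h | ⟨⟨-, h | h⟩, h'⟩ | ⟨⟨-, h | h⟩, h'⟩
    · exact Or.inl h
    · exact Or.inr (Or.inr (Or.inl (Prod.ext (by rw [← h, sub_sub_cancel]) h'.symm)))
    · exact Or.inr (Or.inl (Prod.ext (by rw [← h, add_sub_cancel]) h'.symm))
    · exact Or.inr (Or.inr (Or.inr (Or.inr (Prod.ext h'.symm (by rw [← h, sub_sub_cancel])))))
    · exact Or.inr (Or.inr (Or.inr (Or.inl (Prod.ext h'.symm (by rw [← h, add_sub_cancel])))))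
  exact (Finset.card_le_card hsub).trans Finset.card_le_five

theorem toReal_localMobility (m : ℕ) (a v : ZMod s × ZMod s) :
    (localMobility s m a v).toReal
      = if v ∈ localSquare s m a then ((localSquare s m 0).card : ℝ)⁻¹ else 0 := by
  rw [localMobility, PMF.uniformOfFinset_apply]
  split_ifs
  · rw [card_localSquare, ENNReal.toReal_inv, ENNReal.toReal_natCast]
  · exact ENNReal.toReal_zero

theorem cast_card_localSquare_pos (m : ℕ) : (0 : ℝ) < (localSquare s m 0).card := by
  exact_mod_cast Finset.card_pos.2 (localSquare_nonempty s m 0)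

/-- The mobility preserves the uniform distribution. -/
theorem sum_localMobility [NeZero s] (m : ℕ) (u : ZMod s × ZMod s) :
    ∑ k, (localMobility s m k u).toReal = 1 := by
  have hB := cast_card_localSquare_pos (s := s) m
  simp only [toReal_localMobility]
  rw [← Equiv.sum_comp (Equiv.subLeft u)]
  simp only [mem_localSquare_iff m _ u, Equiv.subLeft_apply, sub_sub_cancel]
  rw [Finset.sum_ite_mem, Finset.univ_inter, Finset.sum_const, nsmul_eq_mul,
    mul_inv_cancel₀ hB.ne']

/-- The agents share a site with probability overlap over `β ^ 2`, at least `1 / (4β)`; dividing by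
`D + 1 = 6` gives 24. -/
theorem contactProb_localMobility_ge [NeZero s] {m : ℕ} (hm : m < s) (i : ZMod s × ZMod s)
    {d : ZMod s × ZMod s} (hd : d ∈ localSquare s m 0) (hd0 : d ≠ 0) :
    ENNReal.ofReal (1 / (24 * (localSquare s m 0).card))
      ≤ contactProb (torusGraph s) (localMobility s m) i (i + d) := by
  classical
  have hB := cast_card_localSquare_pos (s := s) m
  refine le_trans (ENNReal.ofReal_le_ofReal ?_) (contactProb_ge (torusGraph s) (localMobility s m)
    (D := 5) (by norm_num) (fun v => ?_) (j := i + d) (by simpa using hd0))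
  · have hsum : ∑ v, (localMobility s m i v).toReal * (localMobility s m (i + d) v).toReal
        = ((localSquare s m 0).filter fun e => e - d ∈ localSquare s m 0).card
          * ((localSquare s m 0).card : ℝ)⁻¹ ^ 2 := by
      rw [← sum_add_right_eq _ i]
      simp only [toReal_localMobility, mem_localSquare_iff m i, mem_localSquare_iff m (i + d),
        add_sub_cancel_right, ite_mul, mul_ite, zero_mul, mul_zero]
      rw [Finset.card_filter, Nat.cast_sum, Finset.sum_mul,
        ← Finset.sum_subset (Finset.subset_univ (localSquare s m 0)) (by
          intro e _ he
          simp [he])]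
      refine Finset.sum_congr rfl fun e he => ?_
      rw [show e + i - (i + d) = e - d by abel, if_pos he]
      split_ifs
      · simp [sq]
      · simp
    have hO : ((localSquare s m 0).card : ℝ) ≤ 4 * ((localSquare s m 0).filter
        fun e => e - d ∈ localSquare s m 0).card := by
      exact_mod_cast card_localSquare_le_overlap hm hd
    rw [hsum]
    calc 1 / (24 * ((localSquare s m 0).card : ℝ))
        = ((localSquare s m 0).card / 4) * ((localSquare s m 0).card : ℝ)⁻¹ ^ 2 / (5 + 1) := by
          field_simp
          norm_num
      _ ≤ _ := by
          gcongr
          linarith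
  · rw [Finset.sum_comm]
    simp only [sum_localMobility, Finset.sum_const, nsmul_eq_mul, mul_one]
    have := card_torusGraph_neighborhood_le v
    norm_cast
    convert this

/-- The spectral gap of the gossip algorithm under local mobility. -/
theorem disagreement_le_dirichlet [NeZero s] {m k : ℕ} (hm : m < s) (hk : s ≤ k * m)
    (y : EuclideanSpace ℝ (ZMod s × ZMod s)) :
    ENNReal.ofReal (1 / (384 * (s : ℝ) ^ 2 * (k : ℝ) ^ 2) * disagreement y)
      ≤ (Fintype.card (ZMod s × ZMod s) : ℝ≥0∞)⁻¹ *
        ∑ i, ∑ j, contactProb (torusGraph s) (localMobility s m) i j *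
          ENNReal.ofReal ((y i - y j) ^ 2 / 2) := by
  have hB := cast_card_localSquare_pos (s := s) m
  have hs : (0 : ℝ) < s := by exact_mod_cast NeZero.pos s
  have hk0 : (0 : ℝ) < k := by
    have : k ≠ 0 := by rintro rfl; have := NeZero.pos s; omega
    exact_mod_cast Nat.pos_of_ne_zero this
  have hcard : (Fintype.card (ZMod s × ZMod s) : ℝ) = (s : ℝ) ^ 2 := by
    rw [Fintype.card_prod, ZMod.card, Nat.cast_mul, sq]
  have hinv : (Fintype.card (ZMod s × ZMod s) : ℝ≥0∞)⁻¹ = ENNReal.ofReal ((s : ℝ) ^ 2)⁻¹ := by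
    rw [ENNReal.ofReal_inv_of_pos (by positivity), ← hcard, ENNReal.ofReal_natCast]
  have hP := disagreement_le_sum_translationEnergy hm hk y
  set β : ℝ := ((localSquare s m 0).card : ℝ)
  set S := ∑ d ∈ localSquare s m 0, translationEnergy (fun v => y v) d with hS
  -- Here `384 = 24 * 2 * 8`: contact bound, halved squares, Poincaré constant.
  calc ENNReal.ofReal (1 / (384 * (s : ℝ) ^ 2 * (k : ℝ) ^ 2) * disagreement y)
      ≤ ENNReal.ofReal (((s : ℝ) ^ 2)⁻¹ * (1 / (24 * β) * (S / 2))) := by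
        refine ENNReal.ofReal_le_ofReal ?_
        have h : disagreement y ≤ 8 * (k : ℝ) ^ 2 * S / β := by
          rw [le_div_iff₀ hB]
          linarith
        calc 1 / (384 * (s : ℝ) ^ 2 * (k : ℝ) ^ 2) * disagreement y
            ≤ 1 / (384 * (s : ℝ) ^ 2 * (k : ℝ) ^ 2) * (8 * (k : ℝ) ^ 2 * S / β) := by gcongr
          _ = _ := by
            field_simp
            ring
    _ = (Fintype.card (ZMod s × ZMod s) : ℝ≥0∞)⁻¹ * ∑ i, ∑ d ∈ localSquare s m 0,
          ENNReal.ofReal (1 / (24 * β)) * ENNReal.ofReal ((y i - y (i + d)) ^ 2 / 2) := by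
        rw [hinv, ENNReal.ofReal_mul (by positivity), ENNReal.ofReal_mul (by positivity)]
        congr 1
        simp only [← Finset.mul_sum]
        congr 1
        rw [Finset.sum_comm, hS, Finset.sum_div, ENNReal.ofReal_sum_of_nonneg
          fun d _ => div_nonneg (translationEnergy_nonneg _ d) zero_le_two]
        refine Finset.sum_congr rfl fun d _ => ?_
        rw [translationEnergy, Finset.sum_div, ENNReal.ofReal_sum_of_nonneg
          fun v _ => by positivity]
    _ ≤ _ := by
        refine mul_le_mul_right (Finset.sum_le_sum fun i _ => ?_) _
        rw [← Equiv.sum_comp (Equiv.addLeft i)]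
        refine le_trans (Finset.sum_le_sum fun d hd => ?_) (Finset.sum_le_univ_sum_of_nonneg
          (s := localSquare s m 0) fun d => zero_le)
        rw [Equiv.coe_addLeft]
        by_cases hd0 : d = 0
        · simp [hd0]
        · exact mul_le_mul_left (contactProb_localMobility_ge hm i hd hd0) _

/-- A contraction of the expected disagreement bounds the averaging time. -/
theorem averagingTime_le {A V : Type*} [Fintype A] [Nonempty A] [Fintype V] (G : SimpleGraph V)
    (μ : A → PMF V) {g ε : ℝ} (hg0 : 0 < g) (hg1 : g ≤ 1) (hε : 0 < ε)
    (h : ∀ y, (gossipStep G μ y).expect (fun z => ENNReal.ofReal (disagreement z))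
      ≤ ENNReal.ofReal (1 - g) * ENNReal.ofReal (disagreement y)) :
    averagingTime G μ ε ≤ (⌈3 * Real.log ε⁻¹ / g⌉₊ : ℕ∞) := by
  refine iSup₂_le fun x hx => iInf₂_le _ ?_
  refine (errorProb_le G μ hx hε (sub_nonneg.2 hg1) h _).trans (ENNReal.ofReal_le_ofReal ?_)
  set t := ⌈3 * Real.log ε⁻¹ / g⌉₊
  rw [div_le_iff₀ (by positivity)]
  -- Markov's bound `(1 - g) ^ t / ε ^ 2` must be at most `ε`, so `(1 - g) ^ t ≤ ε ^ 3` is needed: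
  -- hence the factor 3.
  have ht : 3 * Real.log ε⁻¹ ≤ t * g := by
    rw [← div_le_iff₀ hg0]
    exact Nat.le_ceil _
  calc (1 - g) ^ t ≤ Real.exp (-g) ^ t :=
        pow_le_pow_left₀ (sub_nonneg.2 hg1) (by linarith [Real.add_one_le_exp (-g)]) t
    _ = Real.exp (-(t * g)) := by rw [← Real.exp_nat_mul]; ring_nf
    _ ≤ Real.exp (3 * Real.log ε) := by
        refine Real.exp_le_exp.2 ?_
        rw [Real.log_inv] at ht
        linarith
    _ = ε * ε ^ 2 := by
        rw [mul_comm, Real.exp_mul, Real.exp_log hε]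
        norm_cast
        ring

end LocalMobility

/-! ### Choice of constants -/

theorem theorem3 :
    ∃ C : ℝ, 0 < C ∧ ∀ (n s m : ℕ) [NeZero s], n = s ^ 2 → 2 ≤ m → 2 * m + 1 ≤ s →
      ∀ ε : ℝ, 0 < ε → ε ≤ 1 - 1 / (n : ℝ) →
        ((averagingTime (torusGraph s) (localMobility s m) ε : ℕ∞) : ℝ≥0∞) ≤
          ENNReal.ofReal
            (C * ((n : ℝ) ^ 2 * Real.log (m : ℝ) / (m : ℝ) ^ 2 * Real.log ε⁻¹)) := by
  refine ⟨20000, by norm_num, ?_⟩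
  rintro n s m _ rfl hm hms ε hε hε1
  have hs : (0 : ℝ) < s := by exact_mod_cast NeZero.pos s
  have hm2 : (2 : ℝ) ≤ m := by exact_mod_cast hm
  have hm0 : (0 : ℝ) < m := by linarith
  have hsm : 2 * (m : ℝ) + 1 ≤ s := by exact_mod_cast hms
  have hk : s ≤ (s / m + 1) * m := by
    rw [mul_comm]
    exact (Nat.lt_mul_div_succ s (by omega)).le
  set k := s / m + 1 with hkdef
  have hk1 : (1 : ℝ) ≤ k := by
    rw [hkdef]
    push_cast
    linarith [Nat.cast_nonneg (α := ℝ) (s / m)]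
  have hk2 : (k : ℝ) ≤ 2 * s / m := by
    rw [hkdef, Nat.cast_add, Nat.cast_one]
    have h1 : ((s / m : ℕ) : ℝ) ≤ s / m := Nat.cast_div_le
    have h2 : (1 : ℝ) ≤ s / m := by
      rw [one_le_div hm0]
      linarith
    rw [mul_div_assoc]
    linarith
  have hg0 : (0 : ℝ) < 1 / (384 * (s : ℝ) ^ 2 * (k : ℝ) ^ 2) := by positivity
  have hg1 : 1 / (384 * (s : ℝ) ^ 2 * (k : ℝ) ^ 2) ≤ 1 := by
    rw [div_le_one (by positivity)]
    nlinarith [one_le_pow₀ hk1 (n := 2), one_le_pow₀ (show (1 : ℝ) ≤ s by linarith) (n := 2)]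
  have hT := averagingTime_le (torusGraph s) (localMobility s m) hg0 hg1 hε fun y =>
    expect_gossipStep_disagreement_le _ _ hg0.le y (disagreement_le_dirichlet (by omega) hk y)
  refine (ENat.toENNReal_le.2 hT).trans ?_
  rw [ENat.toENNReal_coe, ← ENNReal.ofReal_natCast]
  refine ENNReal.ofReal_le_ofReal ?_
  -- From `log ε ≤ ε - 1 ≤ -1 / n`. This makes `Q ≥ 1` below, which absorbs the rounding up to an
  -- integer time.
  have hL : 1 / (s : ℝ) ^ 2 ≤ Real.log ε⁻¹ := by
    rw [Real.log_inv]
    push_cast at hε1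
    linarith [Real.log_le_sub_one_of_pos hε]
  have hL0 : 0 < Real.log ε⁻¹ := lt_of_lt_of_le (by positivity) hL
  have hlogm : 1 / 2 ≤ Real.log m := by
    have := Real.log_le_log two_pos hm2
    linarith [Real.log_two_gt_d9]
  refine (Nat.ceil_lt_add_one (by positivity)).le.trans ?_
  push_cast
  set Q : ℝ := ((s : ℝ) ^ 2) ^ 2 / (m : ℝ) ^ 2 * Real.log ε⁻¹ with hQ
  have hmain : 3 * Real.log ε⁻¹ / (1 / (384 * (s : ℝ) ^ 2 * (k : ℝ) ^ 2)) ≤ 4608 * Q := by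
    calc _ = 1152 * (s : ℝ) ^ 2 * (k : ℝ) ^ 2 * Real.log ε⁻¹ := by
          rw [div_div_eq_mul_div, div_one]
          ring
      _ ≤ 1152 * (s : ℝ) ^ 2 * (2 * s / m) ^ 2 * Real.log ε⁻¹ := by gcongr
      _ = 4608 * Q := by
          rw [hQ]
          field_simp
          ring
  have hone : 1 ≤ Q := by
    calc (1 : ℝ) ≤ (s : ℝ) ^ 2 / (m : ℝ) ^ 2 := by
          rw [one_le_div (by positivity)]
          exact pow_le_pow_left₀ hm0.le (by linarith) 2
      _ = ((s : ℝ) ^ 2) ^ 2 / (m : ℝ) ^ 2 * (1 / (s : ℝ) ^ 2) := by field_simp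
      _ ≤ Q := by rw [hQ]; gcongr
  -- With `log m ≥ 1 / 2`, any constant from `2 * 4609` upwards would do.
  calc _ ≤ 4609 * Q := by linarith
    _ ≤ 20000 * (Q * Real.log m) := by nlinarith
    _ = _ := by rw [hQ]; ring
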